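/- Let $G=(V,D,B)$ be a mixed graph: $V$ is a finite set, $D\subseteq V\times V$ is a set of directed edges $v\to w$, and $B\subseteq V\times V$ is a symmetric set of bidirected edges $v\leftrightarrow w$; neither contains self-loops. (Directed cycles are allowed.) A trek from a source $v$ to a target $w$ consists of two directed paths $v^L_0\to\cdots\to v^L_l=v$ and $v^R_0\to\cdots\to v^R_r=w$ ($l,r\ge 0$, nodes may repeat) with either $v^L_0=v^R_0$ or $v^L_0\leftrightarrow v^R_0\in B$; put $\mathrm{Left}=\{v^L_0,\dots,v^L_l\}$ and $\mathrm{Right}=\{v^R_0,\dots,v^R_r\}$. A half-trek is a trek with $|\mathrm{Left}|=1$. A system of treks from $X\subseteq V$ to $Y\subseteq V$ is a set of treks whose sources are distinct and form $X$ and whose targets are distinct and form $Y$; it has no sided intersection if any two different treks in it have disjoint left-hand sides and disjoint right-hand sides. Let $\mathrm{pa}(v)=\{w: w\to v\in D\}$, $\mathrm{sib}(v)=\{w: w\leftrightarrow v\in B\}$, and let $\mathrm{htr}(v)$ be the set of nodes in $V\setminus(\{v\}\cup\mathrm{sib}(v))$ that are the target of some half-trek with source $v$. A set $Y\subseteq V$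 satisfies the half-trek criterion with respect to $v$ if (i) $|Y|=|\mathrm{pa}(v)|$, (ii) $Y\cap(\{v\}\cup\mathrm{sib}(v))=\varnothing$, and (iii) there is a system of half-treks with no sided intersection from $Y$ to $\mathrm{pa}(v)$. Let $\Theta$ be the set of pairs $(\Lambda,\Omega)$ of real $V\times V$ matrices such that $\lambda_{vw}=0$ whenever $v\to w\notin D$, $I-\Lambda$ is invertible, $\Omega$ is symmetric positive definite, and $\omega_{vw}=0$ whenever $v\neq w$ and $v\leftrightarrow w\notin B$. Let $\phi_G(\Lambda,\Omega)=(I-\Lambda)^{-T}\,\Omega\,(I-\Lambda)^{-1}$. The graph $G$ is rationally identifiable if there are a proper subset $A\subsetneq\Theta$, defined within $\Theta$ by polynomial equations in the entries of $(\Lambda,\Omega)$, and a rational map $\psi$ (in the entries of the covariance matrix) such that for all $(\Lambda,\Omega)\in\Theta\setminus A$, $\psi$ is defined at $\phi_G(\Lambda,\Omega)$ and $\psi(\phi_G(\Lambda,\Omega))=(\Lambda,\Omega)$. **Theorem (HTC-identifiability).** Let $(Y_v : v\in V)$ be a family of subsets of $V$. If for each $v\in V$ the set $Y_v$ satisfies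 the half-trek criterion with respect to $v$, and there is a (strict) total ordering $\prec$ on $V$ such that $w\prec v$ whenever $w\in Y_v\cap\mathrm{htr}(v)$, then $G$ is rationally identifiable. -/

import Mathlib

/-- A mixed graph on the node set `V`: directed edges `v → w` and bidirected edges `v ↔ w`,
neither kind having self-loops. -/
structure MixedGraph (V : Type*) where
  /-- `dir v w` means `v → w`. -/
  dir : V → V → Prop
  /-- `bi v w` means `v ↔ w`. -/
  bi : V → V → Prop
  dir_irrefl : ∀ v, ¬ dir v v
  bi_irrefl : ∀ v, ¬ bi v v
  bi_symm : ∀ v w, bi v w → bi w v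

namespace MixedGraph

/-- A trek.  `left` lists the nodes of the left-hand side and `right` those of the right-hand side,
both read from the middle of the trek outwards along directed edges.  The two sides either start
at a common top node or at two nodes joined by a bidirected edge. -/
structure Trek {V : Type*} (G : MixedGraph V) where
  left : List V
  right : List V
  left_ne_nil : left ≠ []
  right_ne_nil : right ≠ []
  left_chain : left.IsChain G.dir
  right_chain : right.IsChain G.dir
  middle : left.head left_ne_nil = right.head right_ne_nil ∨
    G.bi (left.head left_ne_nil) (right.head right_ne_nil)

namespace Trek

/-- The source of a trek (the outer end of its left-hand side). -/
def source {V : Type*} {G : MixedGraph V} (π : Trek G) : V := π.left.getLast π.left_ne_nil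

/-- The target of a trek (the outer end of its right-hand side). -/
def target {V : Type*} {G : MixedGraph V} (π : Trek G) : V := π.right.getLast π.right_ne_nil

/-- The set of nodes on the left-hand side. -/
def leftSet {V : Type*} {G : MixedGraph V} (π : Trek G) : Set V := {x | x ∈ π.left}

/-- The set of nodes on the right-hand side. -/
def rightSet {V : Type*} {G : MixedGraph V} (π : Trek G) : Set V := {x | x ∈ π.right}

/-- A half-trek is a trek whose left-hand side has exactly one node. -/
def IsHalfTrek {V : Type*} {G : MixedGraph V} (π : Trek G) : Prop := π.leftSet.ncard = 1

end Trek

/-- `P` is a system of treks from `X` to `Y`: the sources are distinct and form `X`, the targets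
are distinct and form `Y`. -/
def IsTrekSystem {V : Type*} (G : MixedGraph V) (P : Set (Trek G)) (X Y : Set V) : Prop :=
  Set.BijOn Trek.source P X ∧ Set.BijOn Trek.target P Y

/-- A set of treks has no sided intersection. -/
def NoSidedIntersection {V : Type*} (G : MixedGraph V) (P : Set (Trek G)) : Prop :=
  P.Pairwise fun π ρ => Disjoint π.leftSet ρ.leftSet ∧ Disjoint π.rightSet ρ.rightSet

/-- The parents of `v`. -/
def pa {V : Type*} (G : MixedGraph V) (v : V) : Set V := {w | G.dir w v}

/-- The siblings of `v`. -/
def sib {V : Type*} (G : MixedGraph V) (v : V) : Set V := {w | G.bi w v}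

/-- The nodes other than `v` and its siblings that can be reached from `v` via a half-trek. -/
def htr {V : Type*} (G : MixedGraph V) (v : V) : Set V :=
  {w | w ∉ ({v} ∪ G.sib v) ∧ ∃ π : Trek G, π.IsHalfTrek ∧ π.source = v ∧ π.target = w}

/-- `Y` satisfies the half-trek criterion with respect to `v`. -/
def HalfTrekCriterion {V : Type*} (G : MixedGraph V) (v : V) (Y : Set V) : Prop :=
  Y.ncard = (G.pa v).ncard ∧
  Y ∩ ({v} ∪ G.sib v) = ∅ ∧
  ∃ P : Set (Trek G), G.IsTrekSystem P Y (G.pa v) ∧ (∀ π ∈ P, π.IsHalfTrek) ∧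
    G.NoSidedIntersection P

/-- The parameter space `Θ`: pairs `(Λ, Ω)` where `Λ` is supported on the directed edges with
`I - Λ` invertible, and `Ω` is symmetric positive definite and vanishes off the diagonal and the
bidirected edges. -/
def Theta {V : Type*} [Fintype V] [DecidableEq V] (G : MixedGraph V) :
    Set (Matrix V V ℝ × Matrix V V ℝ) :=
  {θ | (∀ v w, ¬ G.dir v w → θ.1 v w = 0) ∧ IsUnit (1 - θ.1) ∧
    θ.2.PosDef ∧ (∀ v w, v ≠ w → ¬ G.bi v w → θ.2 v w = 0)}

/-- The parametrization `(Λ, Ω) ↦ (I - Λ)⁻ᵀ Ω (I - Λ)⁻¹`. -/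
noncomputable def phi {V : Type*} [Fintype V] [DecidableEq V] (θ : Matrix V V ℝ × Matrix V V ℝ) :
    Matrix V V ℝ :=
  ((1 - θ.1)⁻¹).transpose * θ.2 * (1 - θ.1)⁻¹

/-- The coordinates of a pair of matrices: `Sum.inl` for `Λ`, `Sum.inr` for `Ω`. -/
def coords {V : Type*} (θ : Matrix V V ℝ × Matrix V V ℝ) : (V × V) ⊕ (V × V) → ℝ :=
  Sum.elim (fun e => θ.1 e.1 e.2) (fun e => θ.2 e.1 e.2)

/-- An algebraic subset of `Θ`: the points of `Θ` where a set of polynomials in the entries of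
`(Λ, Ω)` vanishes. -/
def IsAlgebraicSubset {V : Type*} [Fintype V] [DecidableEq V] (G : MixedGraph V)
    (A : Set (Matrix V V ℝ × Matrix V V ℝ)) : Prop :=
  ∃ S : Set (MvPolynomial ((V × V) ⊕ (V × V)) ℝ),
    A = {θ | θ ∈ G.Theta ∧ ∀ f ∈ S, MvPolynomial.eval (coords θ) f = 0}

/-- A rational map from matrices to pairs of matrices: every coordinate is a quotient of two
polynomials in the matrix entries. -/
structure RationalMap (V : Type*) where
  num : (V × V) ⊕ (V × V) → MvPolynomial (V × V) ℝ
  den : (V × V) ⊕ (V × V) → MvPolynomial (V × V) ℝ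
  den_ne_zero : ∀ c, den c ≠ 0

/-- `ψ` is defined at `M`: no denominator vanishes there. -/
def RationalMap.DefinedAt {V : Type*} (ψ : RationalMap V) (M : Matrix V V ℝ) : Prop :=
  ∀ c, MvPolynomial.eval (fun e : V × V => M e.1 e.2) (ψ.den c) ≠ 0

/-- The coordinate values of `ψ` at `M`; meaningful where `ψ` is defined. -/
noncomputable def RationalMap.value {V : Type*} (ψ : RationalMap V) (M : Matrix V V ℝ) :
    (V × V) ⊕ (V × V) → ℝ :=
  fun c => MvPolynomial.eval (fun e : V × V => M e.1 e.2) (ψ.num c) /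
    MvPolynomial.eval (fun e : V × V => M e.1 e.2) (ψ.den c)

/-- `G` is rationally identifiable: off a proper algebraic subset of `Θ`, some rational map is
defined on the image of the parametrization and inverts it. -/
def RationallyIdentifiable {V : Type*} [Fintype V] [DecidableEq V] (G : MixedGraph V) : Prop :=
  ∃ A : Set (Matrix V V ℝ × Matrix V V ℝ), G.IsAlgebraicSubset A ∧ A ⊂ G.Theta ∧
    ∃ ψ : RationalMap V, ∀ θ ∈ G.Theta \ A,
      ψ.DefinedAt (phi θ) ∧ ψ.value (phi θ) = coords θ

end MixedGraph

/-! Write Σ for `phi θ`. Every i in `Y v` gives a linear equation for column v of Λ. If i is not in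
htr(v), no half-trek runs from v to i, so Σ(I - Λ) = (I - Λ)⁻ᵀ Ω vanishes at (i, v). If i is in
htr(v), then (I - Λ)ᵀ Σ (I - Λ) = Ω vanishes at (i, v), and the coefficients of this equation need
only Σ and column i of Λ, which is known by induction along the order. The system is square in the
parents of v, so Cramer's rule solves it wherever its determinant is nonzero
(`HalfTrekCriterion.column_mem_recoverable`). Once Λ is known, Ω = (I - Λ)ᵀ Σ (I - Λ) is known too.

It remains to see that the determinant is generically nonzero. It is polynomial up to powers of
det(I - Λ), and `Theta` is Zariski dense in the linear space `paramSpace`, so one point of that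
space suffices. The right-hand sides of the half-treks are disjoint paths from `Y v` to the parents.
Taken of minimal weight, with parameter 1 on what they use and 0 elsewhere, they give a triangular
matrix with positive diagonal (`IsLinkage.exists_rank`). The only obstruction to triangularity would
be sources lying cyclically on each other's paths, and rerouting along such a cycle lowers the
weight (`IsLinkage.head_eq_of_mem_periodicPts`). -/

/-! ### Matrix operations over rings of functions, and positive definiteness. -/

/-- An arbitrary subring of functions is allowed so that the result covers both polynomial functions
and `recoverable`. -/
theorem Matrix.det_mem_of_subring {X n : Type*} [Fintype n] [DecidableEq n]
    (S : Subring (X → ℝ)) (M : X → Matrix n n ℝ) (hM : ∀ i j, (fun x => M x i j) ∈ S) :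
    (fun x => (M x).det) ∈ S := by
  have h : (fun x => (M x).det) =
      ∑ σ : Equiv.Perm n, ((Equiv.Perm.sign σ : ℤ) : X → ℝ) * ∏ i, fun x => M x (σ i) i := by
    funext x
    simp [Matrix.det_apply', Finset.sum_apply, Finset.prod_apply]
  rw [h]
  exact sum_mem fun σ _ => mul_mem (intCast_mem S _) (prod_mem fun i _ => hM _ _)

theorem Matrix.mul_apply_mem_of_subring {X l m n : Type*} [Fintype m]
    (S : Subring (X → ℝ)) (M : X → Matrix l m ℝ) (N : X → Matrix m n ℝ)
    (hM : ∀ i j, (fun x => M x i j) ∈ S) (hN : ∀ i j, (fun x => N x i j) ∈ S) (i : l) (j : n) :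
    (fun x => (M x * N x) i j) ∈ S := by
  have h : (fun x => (M x * N x) i j) = ∑ k, (fun x => M x i k) * fun x => N x k j := by
    funext x
    simp [Matrix.mul_apply, Finset.sum_apply]
  rw [h]
  exact sum_mem fun k _ => mul_mem (hM _ _) (hN _ _)

theorem Matrix.adjugate_apply_mem_of_subring {X n : Type*} [Fintype n] [DecidableEq n]
    (S : Subring (X → ℝ)) (M : X → Matrix n n ℝ) (hM : ∀ i j, (fun x => M x i j) ∈ S) (i j : n) :
    (fun x => (M x).adjugate i j) ∈ S := by
  simp only [Matrix.adjugate_apply]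
  refine Matrix.det_mem_of_subring S (fun x => (M x).updateRow j (Pi.single i 1)) fun a b => ?_
  by_cases ha : a = j
  · subst ha
    by_cases hb : b = i
    · subst hb
      simp only [Matrix.updateRow_self, Pi.single_eq_same]
      exact one_mem S
    · simp only [Matrix.updateRow_self, Pi.single_eq_of_ne hb]
      exact zero_mem S
  · simpa [Matrix.updateRow_apply, ha] using hM a b

/-- Adding a large multiple of the identity makes a symmetric matrix positive definite. -/
theorem Matrix.exists_posDef_add_smul_one {n : Type*} [Fintype n] [DecidableEq n]
    (A : Matrix n n ℝ) (hA : A.transpose = A) :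
    ∃ K : ℝ, ∀ c > K, (A + c • (1 : Matrix n n ℝ)).PosDef := by
  refine ⟨∑ i, ∑ j, |A i j|, fun c hc => Matrix.PosDef.of_dotProduct_mulVec_pos ?_ ?_⟩
  · rw [Matrix.IsHermitian, Matrix.conjTranspose_eq_transpose_of_trivial, Matrix.transpose_add, hA,
      Matrix.transpose_smul, Matrix.transpose_one]
  · intro x hx
    have hpos : 0 < ∑ i, x i * x i := by
      obtain ⟨i, hi⟩ := Function.ne_iff.1 hx
      exact Finset.sum_pos' (fun i _ => mul_self_nonneg _)
        ⟨i, Finset.mem_univ _, mul_self_pos.2 hi⟩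
    have hle : ∀ i, x i * x i ≤ ∑ i, x i * x i := fun i =>
      Finset.single_le_sum (f := fun i => x i * x i) (fun i _ => mul_self_nonneg _)
        (Finset.mem_univ i)
    have hA' : -((∑ i, ∑ j, |A i j|) * ∑ i, x i * x i) ≤ ∑ i, ∑ j, x i * (A i j * x j) := by
      rw [Finset.sum_mul, ← Finset.sum_neg_distrib]
      refine Finset.sum_le_sum fun i _ => ?_
      rw [Finset.sum_mul, ← Finset.sum_neg_distrib]
      refine Finset.sum_le_sum fun j _ => ?_
      have h1 : |x i * x j| ≤ ∑ i, x i * x i := by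
        rw [abs_le]
        constructor <;> nlinarith [hle i, hle j, sq_nonneg (x i + x j), sq_nonneg (x i - x j)]
      have h2 : |x i * (A i j * x j)| ≤ |A i j| * ∑ i, x i * x i := by
        rw [show x i * (A i j * x j) = A i j * (x i * x j) by ring, abs_mul]
        exact mul_le_mul_of_nonneg_left h1 (abs_nonneg _)
      exact (abs_le.1 h2).1
    have hexp : star x ⬝ᵥ (A + c • (1 : Matrix n n ℝ)).mulVec x =
        ∑ i, ∑ j, x i * (A i j * x j) + c * ∑ i, x i * x i := by
      simp only [Matrix.add_mulVec, Matrix.smul_mulVec, Matrix.one_mulVec, dotProduct_add,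
        dotProduct_smul, star_trivial, smul_eq_mul]
      simp [dotProduct, Matrix.mulVec, Finset.mul_sum]
    rw [hexp]
    nlinarith

/-! ### Polynomial functions and generic points of the parameter space. -/

namespace MixedGraph

section Generic

variable {V : Type*} [Fintype V] [DecidableEq V] (G : MixedGraph V)

/-- The linear space of pairs `(Λ, Ω)` with the support prescribed by `G` and `Ω` symmetric. -/
def paramSpace {V : Type*} (G : MixedGraph V) : Submodule ℝ (Matrix V V ℝ × Matrix V V ℝ) where
  carrier := {θ | (∀ v w, ¬ G.dir v w → θ.1 v w = 0) ∧ θ.2.transpose = θ.2 ∧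
    (∀ v w, v ≠ w → ¬ G.bi v w → θ.2 v w = 0)}
  add_mem' := by
    rintro θ η ⟨h1, h2, h3⟩ ⟨k1, k2, k3⟩
    refine ⟨fun v w h => ?_, ?_, fun v w h h' => ?_⟩
    · simp [h1 v w h, k1 v w h]
    · simp [Matrix.transpose_add, h2, k2]
    · simp [h3 v w h h', k3 v w h h']
  zero_mem' := by simp
  smul_mem' := by
    rintro c θ ⟨h1, h2, h3⟩
    refine ⟨fun v w h => ?_, ?_, fun v w h h' => ?_⟩
    · simp [h1 v w h]
    · simp [Matrix.transpose_smul, h2]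
    · simp [h3 v w h h']

/-- The ring of polynomial functions in the entries of `(Λ, Ω)`. -/
noncomputable def polynomialFunctions (V : Type*) :
    Subring (Matrix V V ℝ × Matrix V V ℝ → ℝ) :=
  (RingHom.pi fun θ : Matrix V V ℝ × Matrix V V ℝ => MvPolynomial.eval (coords θ)).range

theorem mem_polynomialFunctions {V : Type*} {F : Matrix V V ℝ × Matrix V V ℝ → ℝ} :
    F ∈ polynomialFunctions V ↔
      ∃ f : MvPolynomial ((V × V) ⊕ (V × V)) ℝ, ∀ θ, MvPolynomial.eval (coords θ) f = F θ := by
  simp only [polynomialFunctions, RingHom.mem_range, funext_iff]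
  rfl

theorem fst_apply_mem_polynomialFunctions {V : Type*} (a b : V) :
    (fun θ : Matrix V V ℝ × Matrix V V ℝ => θ.1 a b) ∈ polynomialFunctions V :=
  mem_polynomialFunctions.2 ⟨.X (.inl (a, b)), fun θ => by simp [coords]⟩

theorem snd_apply_mem_polynomialFunctions {V : Type*} (a b : V) :
    (fun θ : Matrix V V ℝ × Matrix V V ℝ => θ.2 a b) ∈ polynomialFunctions V :=
  mem_polynomialFunctions.2 ⟨.X (.inr (a, b)), fun θ => by simp [coords]⟩

theorem one_sub_apply_mem_polynomialFunctions {V : Type*} [DecidableEq V] (a b : V) :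
    (fun θ : Matrix V V ℝ × Matrix V V ℝ => (1 - θ.1) a b) ∈ polynomialFunctions V := by
  have h : (fun θ : Matrix V V ℝ × Matrix V V ℝ => (1 - θ.1) a b) =
      (fun _ => (1 : Matrix V V ℝ) a b) - fun θ => θ.1 a b := rfl
  rw [h]
  refine sub_mem ?_ (fst_apply_mem_polynomialFunctions a b)
  by_cases hab : a = b
  · subst hab
    simp only [Matrix.one_apply_eq]
    exact one_mem (polynomialFunctions V)
  · simp only [Matrix.one_apply_ne hab]
    exact zero_mem (polynomialFunctions V)

theorem det_one_sub_mem_polynomialFunctions (V : Type*) [Fintype V] [DecidableEq V] :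
    (fun θ : Matrix V V ℝ × Matrix V V ℝ => (1 - θ.1).det) ∈ polynomialFunctions V :=
  Matrix.det_mem_of_subring _ (fun θ : Matrix V V ℝ × Matrix V V ℝ => 1 - θ.1)
    one_sub_apply_mem_polynomialFunctions

theorem exists_polynomial_on_line {V : Type*} {F : Matrix V V ℝ × Matrix V V ℝ → ℝ}
    (hF : F ∈ polynomialFunctions V) (θ δ : Matrix V V ℝ × Matrix V V ℝ) :
    ∃ p : Polynomial ℝ, ∀ t : ℝ, p.eval t = F (θ + t • δ) := by
  obtain ⟨f, hf⟩ := mem_polynomialFunctions.1 hF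
  refine ⟨MvPolynomial.aeval
    (fun c => Polynomial.C (coords θ c) + Polynomial.X * Polynomial.C (coords δ c)) f,
    fun t => ?_⟩
  rw [← hf, ← Polynomial.coe_evalRingHom, MvPolynomial.aeval_def, MvPolynomial.hom_eval₂]
  rw [MvPolynomial.eval, MvPolynomial.coe_eval₂Hom]
  congr 1
  · ext; simp
  · funext c
    rcases c with c | c <;> simp [coords] <;> ring

/-- A linear space is irreducible: on the line through the two given points both functions restrict
to nonzero polynomials in one variable. -/
theorem exists_mul_ne_zero_on_paramSpace {V : Type*} (G : MixedGraph V)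
    {F F' : Matrix V V ℝ × Matrix V V ℝ → ℝ}
    (hF : F ∈ polynomialFunctions V) (hF' : F' ∈ polynomialFunctions V)
    (h : ∃ θ ∈ G.paramSpace, F θ ≠ 0) (h' : ∃ θ ∈ G.paramSpace, F' θ ≠ 0) :
    ∃ θ ∈ G.paramSpace, (F * F') θ ≠ 0 := by
  obtain ⟨θ, hθ, h⟩ := h
  obtain ⟨η, hη, h'⟩ := h'
  obtain ⟨p, hp⟩ := exists_polynomial_on_line hF θ (η - θ)
  obtain ⟨q, hq⟩ := exists_polynomial_on_line hF' θ (η - θ)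
  have hp0 : p ≠ 0 := by
    rintro rfl
    exact h (by simpa using (hp 0).symm)
  have hq0 : q ≠ 0 := by
    rintro rfl
    exact h' (by simpa using (hq 1).symm)
  have : ∃ t, (p * q).eval t ≠ 0 := by
    by_contra! hc
    exact mul_ne_zero hp0 hq0 (Polynomial.funext (by simpa using hc))
  obtain ⟨t, ht⟩ := this
  refine ⟨θ + t • (η - θ), add_mem hθ (Submodule.smul_mem _ _ (sub_mem hη hθ)), ?_⟩
  rwa [Polynomial.eval_mul, hp, hq] at ht

/-- Zariski density of `Theta`: adding a multiple c of the identity to Ω keeps the support, makes Ω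
positive definite for large c, and meets only finitely many zeros. -/
theorem exists_ne_zero_on_Theta {F : Matrix V V ℝ × Matrix V V ℝ → ℝ}
    (hF : F ∈ polynomialFunctions V) (h : ∃ θ ∈ G.paramSpace, F θ ≠ 0) :
    ∃ θ ∈ G.Theta, F θ ≠ 0 := by
  -- The determinant is included as a factor so that I - Λ ends up invertible as well.
  obtain ⟨θ, ⟨h1, h2, h3⟩, hθ⟩ := G.exists_mul_ne_zero_on_paramSpace
    (det_one_sub_mem_polynomialFunctions V) hF ⟨0, zero_mem _, by simp⟩ h
  obtain ⟨K, hK⟩ := Matrix.exists_posDef_add_smul_one θ.2 h2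
  have hm := mul_mem (det_one_sub_mem_polynomialFunctions V) hF
  obtain ⟨p, hp⟩ := exists_polynomial_on_line hm θ (0, 1)
  have hp0 : p ≠ 0 := by
    rintro rfl
    exact hθ (by simpa using (hp 0).symm)
  obtain ⟨c, hcK, hc⟩ := (Set.Ioi_infinite K).exists_notMem_finset p.roots.toFinset
  have hc : p.eval c ≠ 0 := by
    simpa [hp0] using hc
  rw [hp, Pi.mul_apply, mul_ne_zero_iff] at hc
  refine ⟨θ + c • (0, 1), ⟨fun v w hvw => ?_, ?_, ?_, fun v w hne hvw => ?_⟩, hc.2⟩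
  · simp [h1 v w hvw]
  · exact (Matrix.isUnit_iff_isUnit_det _).2 hc.1.isUnit
  · simpa using hK c hcK
  · simp [h3 v w hne hvw, hne]

/-- `p` holds on `Θ` off the zero set of a polynomial that does not vanish identically. -/
def Generically (p : Matrix V V ℝ × Matrix V V ℝ → Prop) : Prop :=
  ∃ F ∈ polynomialFunctions V, (∃ θ ∈ G.paramSpace, F θ ≠ 0) ∧ ∀ θ ∈ G.Theta, F θ ≠ 0 → p θ

variable {G}

theorem Generically.of_forall {p : Matrix V V ℝ × Matrix V V ℝ → Prop}
    (h : ∀ θ ∈ G.Theta, p θ) : G.Generically p :=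
  ⟨1, one_mem _, ⟨0, zero_mem _, by simp⟩, fun θ hθ _ => h θ hθ⟩

theorem Generically.and {p q : Matrix V V ℝ × Matrix V V ℝ → Prop}
    (hp : G.Generically p) (hq : G.Generically q) : G.Generically fun θ => p θ ∧ q θ := by
  obtain ⟨F, hF, hF0, hFp⟩ := hp
  obtain ⟨F', hF', hF'0, hFq⟩ := hq
  refine ⟨F * F', mul_mem hF hF', G.exists_mul_ne_zero_on_paramSpace hF hF' hF0 hF'0,
    fun θ hθ h => ?_⟩
  rw [Pi.mul_apply, mul_ne_zero_iff] at h
  exact ⟨hFp θ hθ h.1, hFq θ hθ h.2⟩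

theorem Generically.mono {p q : Matrix V V ℝ × Matrix V V ℝ → Prop}
    (hp : G.Generically p) (h : ∀ θ ∈ G.Theta, p θ → q θ) : G.Generically q := by
  obtain ⟨F, hF, hF0, hFp⟩ := hp
  exact ⟨F, hF, hF0, fun θ hθ h' => h θ hθ (hFp θ hθ h')⟩

theorem Generically.forall_finite {ι : Type*} [Finite ι]
    {p : ι → Matrix V V ℝ × Matrix V V ℝ → Prop} (hp : ∀ i, G.Generically (p i)) :
    G.Generically fun θ => ∀ i, p i θ := by
  classical
  cases nonempty_fintype ι
  suffices h : ∀ s : Finset ι, G.Generically fun θ => ∀ i ∈ s, p i θ from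
    (h Finset.univ).mono fun θ _ h i => h i (Finset.mem_univ i)
  intro s
  induction s using Finset.induction_on with
  | empty => exact .of_forall (by simp)
  | insert a s _ ih =>
    refine ((hp a).and ih).mono fun θ _ h => ?_
    simpa using h

theorem Generically.exists_mem_Theta {p : Matrix V V ℝ × Matrix V V ℝ → Prop}
    (hp : G.Generically p) : ∃ θ ∈ G.Theta, p θ := by
  obtain ⟨F, hF, hF0, hFp⟩ := hp
  obtain ⟨θ, hθ, h⟩ := G.exists_ne_zero_on_Theta hF hF0
  exact ⟨θ, hθ, hFp θ hθ h⟩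

/-! ### Functions that are generically rational in the covariance matrix. -/

variable (G)

/-- `g` is generically a rational function of the covariance matrix. -/
def Recoverable (g : Matrix V V ℝ × Matrix V V ℝ → ℝ) : Prop :=
  ∃ num den : MvPolynomial (V × V) ℝ, G.Generically fun θ =>
    MvPolynomial.eval (fun e : V × V => phi θ e.1 e.2) den ≠ 0 ∧
    MvPolynomial.eval (fun e : V × V => phi θ e.1 e.2) num /
      MvPolynomial.eval (fun e : V × V => phi θ e.1 e.2) den = g θ

/-- The ring of functions that are generically rational in the covariance matrix. -/
def recoverable : Subring (Matrix V V ℝ × Matrix V V ℝ → ℝ) where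
  carrier := {g | G.Recoverable g}
  mul_mem' := by
    rintro g g' ⟨n, d, h⟩ ⟨n', d', h'⟩
    refine ⟨n * n', d * d', (h.and h').mono ?_⟩
    rintro θ - ⟨⟨h1, h2⟩, h3, h4⟩
    simp only [map_mul, Pi.mul_apply]
    exact ⟨mul_ne_zero h1 h3, by rw [← h2, ← h4, div_mul_div_comm]⟩
  add_mem' := by
    rintro g g' ⟨n, d, h⟩ ⟨n', d', h'⟩
    refine ⟨n * d' + d * n', d * d', (h.and h').mono ?_⟩
    rintro θ - ⟨⟨h1, h2⟩, h3, h4⟩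
    simp only [map_mul, map_add, Pi.add_apply]
    exact ⟨mul_ne_zero h1 h3, by rw [← h2, ← h4, div_add_div _ _ h1 h3]⟩
  one_mem' := ⟨1, 1, .of_forall (by simp)⟩
  zero_mem' := ⟨0, 1, .of_forall (by simp)⟩
  neg_mem' := by
    rintro g ⟨n, d, h⟩
    refine ⟨-n, d, h.mono ?_⟩
    rintro θ - ⟨h1, h2⟩
    exact ⟨h1, by rw [map_neg, neg_div, h2, Pi.neg_apply]⟩

variable {G}

theorem mem_recoverable_congr {g g' : Matrix V V ℝ × Matrix V V ℝ → ℝ} (hg : g ∈ G.recoverable)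
    (h : G.Generically fun θ => g θ = g' θ) : g' ∈ G.recoverable := by
  obtain ⟨n, d, hnd⟩ := hg
  refine ⟨n, d, (hnd.and h).mono ?_⟩
  rintro θ - ⟨⟨h1, h2⟩, h3⟩
  exact ⟨h1, h2.trans h3⟩

theorem inv_mem_recoverable {g : Matrix V V ℝ × Matrix V V ℝ → ℝ} (hg : g ∈ G.recoverable)
    (h : G.Generically fun θ => g θ ≠ 0) : (fun θ => (g θ)⁻¹) ∈ G.recoverable := by
  obtain ⟨n, d, hnd⟩ := hg
  refine ⟨d, n, (hnd.and h).mono ?_⟩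
  rintro θ - ⟨⟨h1, h2⟩, h3⟩
  rw [← h2] at h3
  exact ⟨fun h0 => h3 (by rw [h0, zero_div]), by beta_reduce; rw [← h2, inv_div]⟩

theorem phi_apply_mem_recoverable (a b : V) : (fun θ => phi θ a b) ∈ G.recoverable :=
  ⟨.X (a, b), 1, .of_forall (by simp)⟩

/-- The finitely many coordinates share one exceptional polynomial, whose zero set in `Theta` serves
as the excluded subset. -/
theorem rationallyIdentifiable_of_recoverable
    (h1 : ∀ a b, (fun θ : Matrix V V ℝ × Matrix V V ℝ => θ.1 a b) ∈ G.recoverable)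
    (h2 : ∀ a b, (fun θ : Matrix V V ℝ × Matrix V V ℝ => θ.2 a b) ∈ G.recoverable) :
    G.RationallyIdentifiable := by
  have h : ∀ c, (fun θ => coords θ c) ∈ G.recoverable := by
    rintro (c | c)
    · exact h1 _ _
    · exact h2 _ _
  choose num den hnd using h
  obtain ⟨F, hF, hF0, hFp⟩ := Generically.forall_finite hnd
  obtain ⟨f, hf⟩ := mem_polynomialFunctions.1 hF
  obtain ⟨η, hη, hη0⟩ := G.exists_ne_zero_on_Theta hF hF0
  refine ⟨{θ | θ ∈ G.Theta ∧ F θ = 0}, ⟨{f}, by simp [hf]⟩,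
    ⟨fun θ hθ => hθ.1, fun hsub => hη0 (hsub hη).2⟩,
    ⟨num, den, fun c hc => ?_⟩, fun θ hθ => ?_⟩
  -- A denominator is a nonzero polynomial because it is nonzero at some covariance matrix.
  · obtain ⟨θ, -, hθ, -⟩ := (hnd c).exists_mem_Theta
    exact hθ (by simp [hc])
  · have := hFp θ hθ.1 fun h0 => hθ.2 ⟨hθ.1, h0⟩
    exact ⟨fun c => (this c).1, funext fun c => (this c).2⟩

end Generic

end MixedGraph

/-! ### Disjoint path families of minimal weight. -/

theorem List.IsChain.exists_nodup {α : Type*} {r : α → α → Prop} {l : List α}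
    (hl : l.IsChain r) :
    ∃ l' : List α, l'.IsChain r ∧ l'.Nodup ∧ l'.head? = l.head? ∧ l'.getLast? = l.getLast? ∧
      l' ⊆ l := by
  classical
  induction l with
  | nil => exact ⟨[], by simp⟩
  | cons a l ih =>
    obtain ⟨l', h1, h2, h3, h4, h5⟩ := ih hl.tail
    by_cases ha : a ∈ l'
    -- Cut out the loop: jump from the first node to its later occurrence.
    · obtain ⟨s, t, rfl⟩ := List.append_of_mem ha
      refine ⟨a :: t, h1.suffix ⟨s, rfl⟩, h2.sublist (List.sublist_append_right _ _), rfl, ?_, ?_⟩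
      · have hl0 : l ≠ [] := by
          rintro rfl
          simp at h4
        rw [List.getLast?_append_of_ne_nil _ (by simp)] at h4
        rw [h4, List.getLast?_cons_of_ne_nil hl0]
      · intro x hx
        exact List.mem_cons_of_mem _ (h5 (List.mem_append_right _ hx))
    · refine ⟨a :: l', ?_, List.nodup_cons.2 ⟨ha, h2⟩, rfl, ?_, ?_⟩
      · rw [List.isChain_cons] at hl ⊢
        exact ⟨by rw [h3]; exact hl.1, h1⟩
      · rw [List.getLast?_cons, List.getLast?_cons, h4]
      · exact List.cons_subset_cons a h5

namespace MixedGraph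

variable {V ι : Type*}

/-- A family of disjoint directed simple paths `R i` ending in `P`, each starting at `y i` or at
a sibling of `y i`. -/
structure IsLinkage (G : MixedGraph V) (y : ι → V) (P : Set V) (R : ι → List V) : Prop where
  ne_nil : ∀ i, R i ≠ []
  chain : ∀ i, (R i).IsChain G.dir
  nodup : ∀ i, (R i).Nodup
  head : ∀ i a, (R i).head? = some a → a = y i ∨ G.bi (y i) a
  last : ∀ i a, (R i).getLast? = some a → a ∈ P
  disjoint : ∀ i j a, a ∈ R i → a ∈ R j → i = j

open Classical in
/-- The number of nodes of the paths plus the number of paths that start at a sibling. -/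
noncomputable def linkageWeight [Fintype ι] (y : ι → V) (R : ι → List V) : ℕ :=
  ∑ i, ((R i).length + if (R i).head? = some (y i) then 0 else 1)

theorem IsLinkage.exists_minimal [Fintype ι] {G : MixedGraph V} {y : ι → V} {P : Set V}
    {R : ι → List V} (hR : G.IsLinkage y P R) :
    ∃ R, G.IsLinkage y P R ∧
      ∀ R', G.IsLinkage y P R' → linkageWeight y R ≤ linkageWeight y R' := by
  obtain ⟨R', hR', hmin⟩ := (measure (linkageWeight y)).wf.has_min
    {R | G.IsLinkage y P R} ⟨R, hR⟩
  exact ⟨R', hR', fun R'' h => not_lt.1 (hmin R'' h)⟩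

/-- In a linkage of minimal weight, the indices which are permuted cyclically by "`y i` lies on the
path of `f i`" have paths that start at `y i`. -/
theorem IsLinkage.head_eq_of_mem_periodicPts [Fintype ι] {G : MixedGraph V} {y : ι → V}
    {P : Set V} {R : ι → List V} (hR : G.IsLinkage y P R)
    (hmin : ∀ R', G.IsLinkage y P R' → linkageWeight y R ≤ linkageWeight y R')
    {f : ι → ι} (hf : ∀ i, y i ∈ R (f i) ∨ f i = i) {i : ι} (hi : i ∈ Function.periodicPts f)
    (hiR : y i ∈ R (f i)) : (R i).head? = some (y i) := by
  classical
  -- The indices on the cycles of `f`, without fixed points whose source misses their own path; `f`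
  -- permutes this set.
  let C : Finset ι := {i | i ∈ Function.periodicPts f ∧ y i ∈ R (f i)}
  have hC : ∀ {i}, i ∈ C ↔ i ∈ Function.periodicPts f ∧ y i ∈ R (f i) := by simp [C]
  have hb := Function.bijOn_periodicPts f
  have hmaps : ∀ i ∈ C, f i ∈ C := by
    intro i hi
    rw [hC] at hi ⊢
    refine ⟨hb.mapsTo hi.1, (hf (f i)).elim id fun h => ?_⟩
    have hfix : f i = i := hb.injOn (hb.mapsTo hi.1) hi.1 h
    simpa only [hfix] using hi.2
  have hinj : Set.InjOn f C := fun a ha b hb' hab =>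
    hb.injOn (hC.1 ha).1 (hC.1 hb').1 hab
  have himage : C.image f = C :=
    Finset.eq_of_subset_of_card_le (Finset.image_subset_iff.2 hmaps)
      (Finset.card_image_of_injOn hinj).ge
  have hS : ∀ i : ι, ∃ S : List V, i ∈ C → S.head? = some (y i) ∧ S <:+ R (f i) := by
    intro i
    by_cases hi : i ∈ C
    · obtain ⟨s, t, h⟩ := List.append_of_mem (hC.1 hi).2
      exact ⟨y i :: t, fun _ => ⟨rfl, s, h.symm⟩⟩
    · exact ⟨[], fun h => absurd h hi⟩
  choose S hS using hS
  have hSne : ∀ i ∈ C, S i ≠ [] := fun i hi h => by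
    have := (hS i hi).1
    simp [h] at this
  -- Rerouting: each i on a cycle takes over the part of the path of `f i` from `y i` onwards.
  -- Disjointness survives because `f` is a bijection on `C`.
  let R' : ι → List V := fun i => if i ∈ C then S i else R i
  have hR'C : ∀ {i}, i ∈ C → R' i = S i := fun h => if_pos h
  have hR'nC : ∀ {i}, i ∉ C → R' i = R i := fun h => if_neg h
  have hlink : G.IsLinkage y P R' := by
    refine ⟨fun i => ?_, fun i => ?_, fun i => ?_, fun i a => ?_, fun i a => ?_,
      fun i j a hai haj => ?_⟩
    · by_cases hi : i ∈ C
      · rw [hR'C hi]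
        exact hSne i hi
      · rw [hR'nC hi]
        exact hR.ne_nil i
    · by_cases hi : i ∈ C
      · rw [hR'C hi]
        exact (hR.chain (f i)).suffix (hS i hi).2
      · rw [hR'nC hi]
        exact hR.chain i
    · by_cases hi : i ∈ C
      · rw [hR'C hi]
        exact (hR.nodup (f i)).sublist (hS i hi).2.sublist
      · rw [hR'nC hi]
        exact hR.nodup i
    · by_cases hi : i ∈ C
      · rw [hR'C hi, (hS i hi).1, Option.some_inj]
        exact fun h => .inl h.symm
      · rw [hR'nC hi]
        exact hR.head i a
    · by_cases hi : i ∈ C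
      · rw [hR'C hi]
        intro h
        refine hR.last (f i) a ?_
        obtain ⟨s, hs⟩ := (hS i hi).2
        rw [← hs, List.getLast?_append_of_ne_nil _ (hSne i hi), h]
      · rw [hR'nC hi]
        exact hR.last i a
    · by_cases hi : i ∈ C <;> by_cases hj : j ∈ C
      · rw [hR'C hi] at hai
        rw [hR'C hj] at haj
        exact hinj hi hj (hR.disjoint _ _ a ((hS i hi).2.subset hai) ((hS j hj).2.subset haj))
      · rw [hR'C hi] at hai
        rw [hR'nC hj] at haj
        exact absurd (hR.disjoint _ _ a ((hS i hi).2.subset hai) haj ▸ hmaps i hi) hj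
      · rw [hR'nC hi] at hai
        rw [hR'C hj] at haj
        exact absurd (hR.disjoint _ _ a ((hS j hj).2.subset haj) hai ▸ hmaps j hj) hi
      · rw [hR'nC hi] at hai
        rw [hR'nC hj] at haj
        exact hR.disjoint _ _ a hai haj
  by_contra hne
  refine absurd (hmin R' hlink) (not_le.2 ?_)
  -- The new paths are no longer in total than the old ones, since `f` only permutes the latter;
  -- every penalty in `C` disappears, that of `i` included.
  have hlen : ∑ j ∈ C, (R (f j)).length = ∑ j ∈ C, (R j).length := by
    conv_rhs => rw [← himage, Finset.sum_image hinj]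
  have hlt : ∑ j ∈ C, ((R' j).length + if (R' j).head? = some (y j) then 0 else 1) <
      ∑ j ∈ C, ((R j).length + if (R j).head? = some (y j) then 0 else 1) := by
    calc _ ≤ ∑ j ∈ C, (R (f j)).length := Finset.sum_le_sum fun j hj => by
            rw [hR'C hj, if_pos (hS j hj).1]
            exact (hS j hj).2.length_le
      _ = ∑ j ∈ C, (R j).length := hlen
      _ < _ := Finset.sum_lt_sum (fun j _ => Nat.le_add_right _ _)
          ⟨i, hC.2 ⟨hi, hiR⟩, by rw [if_neg hne]; exact Nat.lt_succ_self _⟩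
  unfold linkageWeight
  rw [← Finset.sum_add_sum_compl C, ← Finset.sum_add_sum_compl C (fun j => (R j).length + _)]
  refine add_lt_add_of_lt_of_le hlt (Finset.sum_le_sum fun j hj => ?_)
  rw [hR'nC (Finset.mem_compl.1 hj)]

/-- The paths are the right-hand sides of the half-treks with loops removed. -/
theorem HalfTrekCriterion.exists_isLinkage {G : MixedGraph V} {v : V} {Y : Set V}
    (h : G.HalfTrekCriterion v Y) :
    ∃ R : Y → List V, G.IsLinkage (fun i : Y => (i : V)) (G.pa v) R := by
  obtain ⟨-, -, P, ⟨hsrc, htgt⟩, hhalf, hdisj⟩ := h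
  have hex : ∀ i : Y, ∃ π ∈ P, π.source = i := fun i => hsrc.surjOn i.2
  choose π hπP hπsrc using hex
  -- With a single node on the left, all list entries agree, so the inner end is the source whatever
  -- the length of the list.
  have hleft : ∀ π : Trek G, π.IsHalfTrek → π.left.head π.left_ne_nil = π.source := by
    intro π hπ
    obtain ⟨a, ha⟩ := Set.ncard_eq_one.1 hπ
    have hmem : ∀ x ∈ π.left, x = a := fun x hx => by
      have : x ∈ π.leftSet := hx
      simpa [ha] using this
    rw [hmem _ (List.head_mem _), Trek.source, hmem _ (List.getLast_mem _)]
  have hnd : ∀ i, ∃ l' : List V, l'.IsChain G.dir ∧ l'.Nodup ∧ l'.head? = (π i).right.head? ∧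
      l'.getLast? = (π i).right.getLast? ∧ l' ⊆ (π i).right :=
    fun i => (π i).right_chain.exists_nodup
  choose R h1 h2 h3 h4 h5 using hnd
  refine ⟨R, ⟨fun i hi => ?_, h1, h2, fun i a ha => ?_, fun i a ha => ?_, fun i j a hi hj => ?_⟩⟩
  · have := h3 i
    rw [hi, List.head?_nil] at this
    exact (π i).right_ne_nil (List.head?_eq_none_iff.1 this.symm)
  · rw [h3, List.head?_eq_some_head (π i).right_ne_nil, Option.some_inj] at ha
    have := (π i).middle
    rw [hleft _ (hhalf _ (hπP i)), hπsrc, ha] at this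
    exact this.imp Eq.symm id
  · rw [h4, List.getLast?_eq_some_getLast (π i).right_ne_nil, Option.some_inj] at ha
    rw [← ha]
    exact htgt.mapsTo (hπP i)
  · by_contra hij
    have hne : π i ≠ π j := fun h => hij (Subtype.ext (by rw [← hπsrc i, ← hπsrc j, h]))
    exact Set.disjoint_left.1 (hdisj (hπP i) (hπP j) hne).2 (h5 i hi) (h5 j hj)

end MixedGraph

/-! ### A 0/1 parameter point at which the coefficient matrix is triangular. -/

/-- Triangularity without choosing a linear order: a kernel vector vanishes by induction on the
rank, since row i then reads `M i i * x i = 0`. -/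
theorem Matrix.det_ne_zero_of_rank {n α : Type*} [Fintype n] [DecidableEq n] [Preorder α]
    [WellFoundedLT α] (M : Matrix n n ℝ) (r : n → α) (hdiag : ∀ i, M i i ≠ 0)
    (hM : ∀ i j, M i j ≠ 0 → i = j ∨ r j < r i) : M.det ≠ 0 := by
  intro hdet
  obtain ⟨x, hx, hMx⟩ := Matrix.exists_mulVec_eq_zero_iff.2 hdet
  refine hx (funext fun i => ?_)
  induction hi : r i using WellFoundedLT.induction generalizing i with
  | ind a ih =>
    subst hi
    have h := congrFun hMx i
    rw [Matrix.mulVec, dotProduct, Finset.sum_eq_single i] at h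
    · exact (mul_eq_zero.1 h).resolve_left (hdiag i)
    · intro j _ hji
      by_cases h0 : M i j = 0
      · rw [h0, zero_mul]
      · rw [ih _ ((hM i j h0).resolve_left hji.symm) j rfl, Pi.zero_apply, mul_zero]
    · simp

/-- If the periodic points of a self-map of a finite type are fixed, then the type is a forest. -/
theorem Function.exists_depth {ι : Type*} [Finite ι] {f : ι → ι}
    (h : ∀ i ∈ Function.periodicPts f, f i = i) :
    ∃ d : ι → ℕ, ∀ i, f i ≠ i → d i = d (f i) + 1 := by
  classical
  have hex : ∀ i, ∃ n, f (f^[n] i) = f^[n] i := by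
    intro i
    obtain ⟨m, n, hmn, heq⟩ := Finite.exists_ne_map_eq_of_infinite fun n : ℕ => f^[n] i
    wlog hlt : m < n generalizing m n
    · exact this n m hmn.symm heq.symm (by lia)
    refine ⟨m, h _ (Function.mk_mem_periodicPts (n := n - m) (by lia) ?_)⟩
    rw [Function.IsPeriodicPt, Function.IsFixedPt, ← Function.iterate_add_apply,
      Nat.sub_add_cancel hlt.le]
    exact heq.symm
  -- The depth is the number of steps until a fixed point is reached.
  refine ⟨fun i => Nat.find (hex i), fun i hi => le_antisymm (Nat.find_min' _ ?_) ?_⟩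
  · rw [Function.iterate_succ_apply]
    exact Nat.find_spec (hex (f i))
  · obtain ⟨m, hm⟩ : ∃ m, Nat.find (hex i) = m + 1 := by
      refine Nat.exists_eq_succ_of_ne_zero fun h0 => hi ?_
      simpa [h0] using Nat.find_spec (hex i)
    have hs := Nat.find_spec (hex i)
    rw [hm, Function.iterate_succ_apply] at hs
    refine le_of_le_of_eq ?_ hm.symm
    exact Nat.succ_le_succ (Nat.find_min' _ hs)

namespace MixedGraph

variable {V ι : Type*}

/-- The matrix of the linear equations for the column of `Λ` at a node: the row of `i` holds
half-trek sums if `h i` and covariances otherwise. -/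
noncomputable def trekMatrix [Fintype V] [DecidableEq V] (h : ι → Prop) [DecidablePred h]
    (y p : ι → V) (θ : Matrix V V ℝ × Matrix V V ℝ) : Matrix ι ι ℝ :=
  Matrix.of fun i j =>
    if h i then (θ.2 * (1 - θ.1)⁻¹) (y i) (p j) else phi θ (y i) (p j)

/-- `a → b` is an edge of a path of the family. -/
def PathEdge (R : ι → List V) (a b : V) : Prop :=
  ∃ (i : ι) (k : ℕ), (R i)[k]? = some a ∧ (R i)[k + 1]? = some b

/-- `a` equals `b` or precedes it on a path of the family. -/
def PathLE (R : ι → List V) (a b : V) : Prop :=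
  a = b ∨ ∃ (i : ι) (k l : ℕ), k ≤ l ∧ (R i)[k]? = some a ∧ (R i)[l]? = some b

/-- One of `a`, `b` is `y i` and the other one is the first node of the path of `i`. -/
def PathStart (y : ι → V) (R : ι → List V) (a b : V) : Prop :=
  ∃ i, (a = y i ∧ (R i).head? = some b) ∨ (b = y i ∧ (R i).head? = some a)

open Classical in
/-- The adjacency matrix of the edges of the paths. -/
noncomputable def pathEdgeMatrix (R : ι → List V) : Matrix V V ℝ :=
  Matrix.of fun a b => if PathEdge R a b then 1 else 0

open Classical in
/-- The zeta matrix of the order along the paths. -/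
noncomputable def pathLEMatrix (R : ι → List V) : Matrix V V ℝ :=
  Matrix.of fun a b => if PathLE R a b then 1 else 0

open Classical in
/-- The adjacency matrix of the pairs `y i`, first node of the path of `i`. -/
noncomputable def pathStartMatrix (y : ι → V) (R : ι → List V) : Matrix V V ℝ :=
  Matrix.of fun a b => if PathStart y R a b then 1 else 0

variable {G : MixedGraph V} {y : ι → V} {P : Set V} {R : ι → List V}

theorem IsLinkage.getElem?_unique (hR : G.IsLinkage y P R) {i j : ι} {k l : ℕ} {a : V}
    (hi : (R i)[k]? = some a) (hj : (R j)[l]? = some a) : i = j ∧ k = l := by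
  obtain rfl := hR.disjoint i j a (List.mem_of_getElem? hi) (List.mem_of_getElem? hj)
  exact ⟨rfl, (List.getElem?_inj (List.getElem?_eq_some_iff.1 hi).1 (hR.nodup i)).1
    (hi.trans hj.symm)⟩

/-- Only `paramSpace` is claimed: this Ω need not be positive definite, as its diagonal may have
zeros. -/
theorem IsLinkage.witness_mem_paramSpace (hR : G.IsLinkage y P R) :
    (pathEdgeMatrix R, pathStartMatrix y R) ∈ G.paramSpace := by
  refine ⟨fun a b hab => ?_, ?_, fun a b hne hab => ?_⟩
  · refine if_neg ?_
    rintro ⟨i, k, hk, hk'⟩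
    obtain ⟨h1, h2⟩ := List.getElem?_eq_some_iff.1 hk
    obtain ⟨h3, h4⟩ := List.getElem?_eq_some_iff.1 hk'
    have := List.isChain_iff_getElem.1 (hR.chain i) k h3
    rw [h2, h4] at this
    exact hab this
  · ext a b
    have : PathStart y R b a ↔ PathStart y R a b := exists_congr fun i => or_comm
    simp only [Matrix.transpose_apply, pathStartMatrix, Matrix.of_apply]
    by_cases hab : PathStart y R a b
    · rw [if_pos hab, if_pos (this.2 hab)]
    · rw [if_neg hab, if_neg fun h => hab (this.1 h)]
  · refine if_neg ?_
    rintro ⟨i, ⟨rfl, hb⟩ | ⟨rfl, ha⟩⟩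
    · exact (hR.head i b hb).elim (fun h => hne h.symm) hab
    · exact (hR.head i a ha).elim hne fun h => hab (G.bi_symm _ _ h)

/-- By disjointness and simplicity a node b has at most one predecessor c along the paths, and a
precedes or equals b exactly when a = b or a precedes or equals c. -/
theorem IsLinkage.pathLEMatrix_mul_one_sub [Fintype V] [DecidableEq V]
    (hR : G.IsLinkage y P R) : pathLEMatrix R * (1 - pathEdgeMatrix R) = 1 := by
  classical
  rw [Matrix.mul_sub, Matrix.mul_one]
  ext a b
  rw [Matrix.sub_apply, Matrix.mul_apply]
  by_cases hb : ∃ i k c, (R i)[k]? = some c ∧ (R i)[k + 1]? = some b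
  · obtain ⟨i, k, c, hc, hb⟩ := hb
    have hsum : ∑ x, pathLEMatrix R a x * pathEdgeMatrix R x b = pathLEMatrix R a c := by
      rw [Finset.sum_eq_single c]
      · simp [pathEdgeMatrix, show PathEdge R c b from ⟨i, k, hc, hb⟩]
      · intro d _ hdc
        rw [pathEdgeMatrix, Matrix.of_apply, if_neg, mul_zero]
        rintro ⟨j, l, hd, hb'⟩
        obtain ⟨rfl, hl⟩ := hR.getElem?_unique hb hb'
        obtain rfl : k = l := by lia
        exact hdc (Option.some_inj.1 (hd.symm.trans hc))
      · simp
    rw [hsum]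
    by_cases hab : a = b
    · subst hab
      have h : ¬ PathLE R a c := by
        rintro (rfl | ⟨j, m, l, hml, hj, hl⟩)
        · have := (hR.getElem?_unique hb hc).2
          lia
        · have h1 := (hR.getElem?_unique hj hb).2
          have h2 := (hR.getElem?_unique hl hc).2
          lia
      simp [pathLEMatrix, show PathLE R a a from Or.inl rfl, h]
    · have h : PathLE R a b ↔ PathLE R a c := by
        constructor
        · rintro (h | ⟨j, m, l, hml, hj, hl⟩)
          · exact absurd h hab
          · obtain ⟨rfl, rfl⟩ := hR.getElem?_unique hl hb
            refine .inr ⟨j, m, k, ?_, hj, hc⟩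
            by_contra hmk
            obtain rfl : m = k + 1 := by lia
            exact hab (Option.some_inj.1 (hj.symm.trans hb))
        · rintro (rfl | ⟨j, m, l, hml, hj, hl⟩)
          · exact .inr ⟨i, k, k + 1, Nat.le_succ k, hc, hb⟩
          · obtain ⟨rfl, rfl⟩ := hR.getElem?_unique hl hc
            exact .inr ⟨j, m, l + 1, by lia, hj, hb⟩
      simp [pathLEMatrix, h, hab]
  · have hsum : ∑ x, pathLEMatrix R a x * pathEdgeMatrix R x b = 0 := by
      refine Finset.sum_eq_zero fun d _ => ?_
      rw [pathEdgeMatrix, Matrix.of_apply, if_neg, mul_zero]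
      rintro ⟨j, l, hd, hb'⟩
      exact hb ⟨j, l, d, hd, hb'⟩
    have h : PathLE R a b ↔ a = b := by
      refine ⟨?_, Or.inl⟩
      rintro (h | ⟨j, m, l, hml, hj, hl⟩)
      · exact h
      · by_contra hab
        rcases Nat.lt_or_ge m l with hlt | hge
        · obtain ⟨l, rfl⟩ : ∃ l', l = l' + 1 := ⟨l - 1, by lia⟩
          have := (List.getElem?_eq_some_iff.1 hl).1
          exact hb ⟨j, l, (R j)[l], List.getElem?_eq_getElem _, hl⟩
        · obtain rfl : m = l := le_antisymm hml hge
          exact hab (Option.some_inj.1 (hj.symm.trans hl))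
    rw [hsum, sub_zero]
    simp [pathLEMatrix, h, Matrix.one_apply]

theorem IsLinkage.inv_one_sub [Fintype V] [DecidableEq V] (hR : G.IsLinkage y P R) :
    (1 - pathEdgeMatrix R)⁻¹ = pathLEMatrix R :=
  Matrix.inv_eq_left_inv hR.pathLEMatrix_mul_one_sub

/-- A nonzero entry of such a product has a nonzero term, that is, a trek: left part, middle, right
part. -/
theorem exists_of_sum_mul_mul_ne_zero [Fintype V] {u v : V} {S T U : Matrix V V ℝ}
    (h : (S.transpose * T * U) u v ≠ 0) :
    ∃ a b, S a u ≠ 0 ∧ T a b ≠ 0 ∧ U b v ≠ 0 := by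
  rw [Matrix.mul_apply] at h
  obtain ⟨b, -, hb⟩ := Finset.exists_ne_zero_of_sum_ne_zero h
  rw [mul_ne_zero_iff, Matrix.mul_apply] at hb
  obtain ⟨a, -, ha⟩ := Finset.exists_ne_zero_of_sum_ne_zero hb.1
  rw [mul_ne_zero_iff] at ha
  exact ⟨a, b, ha.1, ha.2, hb.2⟩

theorem mul_apply_pos {l m n : Type*} [Fintype m] {S : Matrix l m ℝ} {T : Matrix m n ℝ}
    (hS : ∀ i j, 0 ≤ S i j) (hT : ∀ i j, 0 ≤ T i j) {i : l} {j : m} {k : n} (h : 0 < S i j)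
    (h' : 0 < T j k) : 0 < (S * T) i k := by
  rw [Matrix.mul_apply]
  exact Finset.sum_pos' (fun x _ => mul_nonneg (hS _ _) (hT _ _))
    ⟨j, Finset.mem_univ j, mul_pos h h'⟩

theorem mul_apply_nonneg {l m n : Type*} [Fintype m] {S : Matrix l m ℝ} {T : Matrix m n ℝ}
    (hS : ∀ i j, 0 ≤ S i j) (hT : ∀ i j, 0 ≤ T i j) (i : l) (k : n) : 0 ≤ (S * T) i k := by
  rw [Matrix.mul_apply]
  exact Finset.sum_nonneg fun x _ => mul_nonneg (hS _ _) (hT _ _)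

theorem pathLEMatrix_nonneg (R : ι → List V) (a b : V) : 0 ≤ pathLEMatrix R a b := by
  rw [pathLEMatrix, Matrix.of_apply]
  split_ifs <;> simp

theorem pathStartMatrix_nonneg (y : ι → V) (R : ι → List V) (a b : V) :
    0 ≤ pathStartMatrix y R a b := by
  rw [pathStartMatrix, Matrix.of_apply]
  split_ifs <;> simp

theorem pathLEMatrix_pos {a b : V} (h : PathLE R a b) : 0 < pathLEMatrix R a b := by
  rw [pathLEMatrix, Matrix.of_apply, if_pos h]
  exact one_pos

theorem pathStartMatrix_pos {a b : V} (h : PathStart y R a b) : 0 < pathStartMatrix y R a b := by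
  rw [pathStartMatrix, Matrix.of_apply, if_pos h]
  exact one_pos

theorem PathLE.of_pathLEMatrix_ne_zero {a b : V} (h : pathLEMatrix R a b ≠ 0) : PathLE R a b := by
  by_contra hab
  exact h (if_neg hab)

theorem PathStart.of_pathStartMatrix_ne_zero {a b : V} (h : pathStartMatrix y R a b ≠ 0) :
    PathStart y R a b := by
  by_contra hab
  exact h (if_neg hab)

/-- In a linkage of minimal weight, the treks made of path segments and one pair `y l`, first node
of the path of `l`, are triangular for a suitable rank. -/
theorem IsLinkage.exists_rank [Fintype ι] (hy : Function.Injective y) (hR : G.IsLinkage y P R)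
    (hmin : ∀ R', G.IsLinkage y P R' → linkageWeight y R ≤ linkageWeight y R')
    {p : ι → V} (hp : ∀ i, (R i).getLast? = some (p i)) :
    ∃ r : ι → ℕ ×ₗ ℕ, ∀ i j a b, PathLE R a (y i) → PathStart y R a b → PathLE R b (p j) →
      i = j ∨ r j < r i := by
  classical
  -- `f i` is the index of the path through `y i`, or i itself if no path passes there.
  let f : ι → ι := fun i => if h : ∃ j, y i ∈ R j then h.choose else i
  have hf : ∀ {i j}, y i ∈ R j → f i = j := by
    intro i j h
    have hex : ∃ j, y i ∈ R j := ⟨j, h⟩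
    have : f i = hex.choose := dif_pos hex
    rw [this]
    exact hR.disjoint _ _ _ hex.choose_spec h
  have hf' : ∀ i, y i ∈ R (f i) ∨ f i = i := by
    intro i
    by_cases h : ∃ j, y i ∈ R j
    · obtain ⟨j, h⟩ := h
      exact .inl ((hf h).symm ▸ h)
    · exact .inr (dif_neg h)
  have hhead : ∀ {i}, i ∈ Function.periodicPts f → y i ∈ R (f i) → (R i).head? = some (y i) :=
    fun hi hiR => hR.head_eq_of_mem_periodicPts hmin hf' hi hiR
  have hfix : ∀ i ∈ Function.periodicPts f, f i = i := by
    intro i hi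
    rcases hf' i with h | h
    · exact hf (List.mem_of_mem_head? (hhead hi h))
    · exact h
  have hheadfix : ∀ {i}, f i = i → y i ∈ R i → (R i).head? = some (y i) := by
    intro i hi hiR
    exact hhead (Function.mk_mem_periodicPts Nat.one_pos hi) (by rwa [hi])
  obtain ⟨d, hd⟩ := Function.exists_depth hfix
  have hpos : ∀ {i j k}, (R j)[k]? = some (y i) → (R (f i)).idxOf (y i) = k := by
    intro i j k h
    have hmem := List.mem_of_getElem? h
    rw [hf hmem]
    refine (hR.getElem?_unique (i := j) (j := j) (a := y i) ?_ h).2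
    rw [List.getElem?_eq_some_iff]
    exact ⟨List.idxOf_lt_length_iff.2 hmem, List.getElem_idxOf _⟩
  have hlast : ∀ {b j}, PathLE R b (p j) → b ∈ R j := by
    rintro b j (rfl | ⟨i, k, l, -, hk, hl⟩)
    · exact List.mem_of_getLast? (hp j)
    · rw [← hR.disjoint i j _ (List.mem_of_getElem? hl) (List.mem_of_getLast? (hp j))]
      exact List.mem_of_getElem? hk
  have hcase : ∀ {i j}, PathLE R (y j) (y i) →
      i = j ∨ toLex (d j, (R (f j)).idxOf (y j)) < toLex (d i, (R (f i)).idxOf (y i)) := by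
    rintro i j (h | ⟨l, m, n, hmn, hj, hi⟩)
    · exact .inl (hy h.symm)
    · by_cases hij : i = j
      · exact .inl hij
      right
      rw [Prod.Lex.toLex_lt_toLex, hpos hj, hpos hi]
      have hmn' : m < n := by
        refine lt_of_le_of_ne hmn fun h => hij ?_
        subst h
        exact hy (Option.some_inj.1 (hi.symm.trans hj))
      have hfi := hf (List.mem_of_getElem? hi)
      have hfj := hf (List.mem_of_getElem? hj)
      -- If `y i` were on its own path it would be the first node there, leaving no room for `y j`
      -- before it.
      have hli : l ≠ i := by
        rintro rfl
        have h0 := hheadfix hfi (List.mem_of_getElem? hi)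
        rw [List.head?_eq_getElem?] at h0
        have := (hR.getElem?_unique h0 hi).2
        lia
      have hdi := hd i (by rwa [hfi])
      by_cases hlj : l = j
      · subst hlj
        left
        rw [hdi, hfi]
        exact Nat.lt_succ_self _
      · right
        have hdj := hd j (by rwa [hfj])
        exact ⟨by rw [hdi, hdj, hfi, hfj], hmn'⟩
  -- The rank compares depth in the forest of `f` first, then the position of `y i` on the path
  -- through it.
  refine ⟨fun i => toLex (d i, (R (f i)).idxOf (y i)), fun i j a b ha hab hb => ?_⟩
  have hbj := hlast hb
  obtain ⟨l, ⟨rfl, hl⟩ | ⟨rfl, hl⟩⟩ := hab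
  · obtain rfl := hR.disjoint l j b (List.mem_of_mem_head? hl) hbj
    exact hcase ha
  -- The middle is traversed backwards, from the first node of path l to `y l`. If l ≠ j, then `f i
  -- = l` and `f l = j`, so i lies two levels deeper than j.
  · have hfl := hf hbj
    by_cases hlj : l = j
    · subst hlj
      rw [hheadfix hfl hbj, Option.some_inj] at hl
      exact hcase (hl ▸ ha)
    right
    have hil : y i ∈ R l := by
      rcases ha with rfl | ⟨i', m, n, -, hm, hn⟩
      · exact List.mem_of_mem_head? hl
      · rw [hR.disjoint l i' a (List.mem_of_mem_head? hl) (List.mem_of_getElem? hm)]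
        exact List.mem_of_getElem? hn
    have hfi := hf hil
    have hli : f i ≠ i := by
      intro h
      obtain rfl : l = i := hfi.symm.trans h
      exact hlj (hfi.symm.trans hfl)
    rw [Prod.Lex.toLex_lt_toLex]
    left
    have h1 := hd i hli
    have h2 := hd l (by rw [hfl]; exact fun h => hlj h.symm)
    rw [hfi] at h1
    rw [hfl] at h2
    change d j < d i
    lia

/-- The path of i itself contributes a positive term to the diagonal entry, and nonnegativity rules
out cancellation. The rank works for every choice of row types `h`. -/
theorem IsLinkage.det_trekMatrix_ne_zero [Fintype V] [DecidableEq V] [Fintype ι] [DecidableEq ι]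
    (hy : Function.Injective y) (hR : G.IsLinkage y P R)
    (hmin : ∀ R', G.IsLinkage y P R' → linkageWeight y R ≤ linkageWeight y R')
    {p : ι → V} (hp : ∀ i, (R i).getLast? = some (p i)) (h : ι → Prop) [DecidablePred h] :
    (trekMatrix h y p (pathEdgeMatrix R, pathStartMatrix y R)).det ≠ 0 := by
  obtain ⟨r, hr⟩ := hR.exists_rank hy hmin hp
  refine Matrix.det_ne_zero_of_rank _ r (fun i => ne_of_gt ?_) fun i j hij => ?_
  · obtain ⟨s, hs⟩ : ∃ s, (R i).head? = some s := ⟨_, List.head?_eq_some_head (hR.ne_nil i)⟩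
    have h1 : 0 < pathStartMatrix y R (y i) s := pathStartMatrix_pos ⟨i, .inl ⟨rfl, hs⟩⟩
    have h2 : 0 < pathLEMatrix R s (p i) := by
      refine pathLEMatrix_pos (Or.inr ⟨i, 0, (R i).length - 1, Nat.zero_le _, ?_, ?_⟩)
      · rw [← List.head?_eq_getElem?, hs]
      · rw [← List.getLast?_eq_getElem?, hp]
    have h3 : 0 < pathLEMatrix R (y i) (y i) := pathLEMatrix_pos (Or.inl rfl)
    simp only [trekMatrix, Matrix.of_apply, phi, hR.inv_one_sub]
    split_ifs
    · exact mul_apply_pos (pathStartMatrix_nonneg y R) (pathLEMatrix_nonneg R) h1 h2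
    · have hT : ∀ a b, 0 ≤ (pathLEMatrix R).transpose a b := fun a b => pathLEMatrix_nonneg R b a
      exact mul_apply_pos (mul_apply_nonneg hT (pathStartMatrix_nonneg y R))
        (pathLEMatrix_nonneg R) (mul_apply_pos hT (pathStartMatrix_nonneg y R) h3 h1) h2
  · simp only [trekMatrix, Matrix.of_apply, phi, hR.inv_one_sub] at hij
    split_ifs at hij
    -- A half-trek row is a trek row with trivial left part, so the identity is inserted as the left
    -- factor.
    · rw [← Matrix.one_mul (pathStartMatrix y R), ← Matrix.transpose_one] at hij
      obtain ⟨a, b, ha, hab, hb⟩ := exists_of_sum_mul_mul_ne_zero hij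
      have ha' : a = y i := by
        by_contra hne
        exact ha (Matrix.one_apply_ne hne)
      exact hr i j a b (Or.inl ha') (.of_pathStartMatrix_ne_zero hab) (.of_pathLEMatrix_ne_zero hb)
    · obtain ⟨a, b, ha, hab, hb⟩ := exists_of_sum_mul_mul_ne_zero hij
      exact hr i j a b (.of_pathLEMatrix_ne_zero ha) (.of_pathStartMatrix_ne_zero hab)
        (.of_pathLEMatrix_ne_zero hb)

end MixedGraph

/-! ### The linear equations for a column of Λ and their solution. -/

/-- The support of the inverse of a matrix lies in every preorder containing the support of the
matrix. -/
theorem Matrix.inv_apply_eq_zero_of_support {n : Type*} [Fintype n] [DecidableEq n]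
    {M : Matrix n n ℝ} (hM : IsUnit M) {Q : n → n → Prop} (hrefl : ∀ a, Q a a)
    (htrans : ∀ a b c, Q a b → Q b c → Q a c) (h : ∀ a b, M a b ≠ 0 → Q a b) {a b : n}
    (hab : ¬ Q a b) : M⁻¹ a b = 0 := by
  classical
  have := hM.invertible
  -- Two blocks suffice: the nodes above `a` and the rest. The inverse inherits block triangularity.
  have htri : M.BlockTriangular fun c => if Q a c then 1 else 0 := by
    intro c d hcd
    by_contra h0
    have hq := h c d h0
    by_cases hc : Q a c
    · simp [hc, htrans a c d hc hq] at hcd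
    · simp [hc] at hcd
  refine Matrix.blockTriangular_inv_of_blockTriangular htri ?_
  simp [hab, hrefl a]

namespace MixedGraph

variable {V : Type*} [Fintype V] [DecidableEq V] {G : MixedGraph V}

/-- Replacing inverses by adjugates makes the determinant polynomial; each row loses one or two
factors 1 / det(I - Λ). -/
theorem generically_det_trekMatrix_ne_zero {ι : Type*} [Fintype ι] [DecidableEq ι] (h : ι → Prop)
    [DecidablePred h] (y p : ι → V) (hex : ∃ θ ∈ G.paramSpace, (trekMatrix h y p θ).det ≠ 0) :
    G.Generically fun θ => (trekMatrix h y p θ).det ≠ 0 := by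
  let M : Matrix V V ℝ × Matrix V V ℝ → Matrix ι ι ℝ := fun θ => Matrix.of fun i j =>
    if h i then (θ.2 * (1 - θ.1).adjugate) (y i) (p j)
    else ((1 - θ.1).adjugate.transpose * θ.2 * (1 - θ.1).adjugate) (y i) (p j)
  -- `Ring.inverse` is 0 at non-units, as is the matrix inverse, so the factorization below holds at
  -- every θ, also at a witness outside `Theta`.
  let u : Matrix V V ℝ × Matrix V V ℝ → ι → ℝ := fun θ i =>
    if h i then Ring.inverse (1 - θ.1).det
    else Ring.inverse (1 - θ.1).det * Ring.inverse (1 - θ.1).det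
  have hdet : ∀ θ, (trekMatrix h y p θ).det = (∏ i, u θ i) * (M θ).det := by
    intro θ
    rw [← Matrix.det_mul_column]
    congr 1
    ext i j
    by_cases hi : h i
    · simp [trekMatrix, M, u, hi, Matrix.inv_def]
    · simp [trekMatrix, M, u, hi, Matrix.inv_def, phi, mul_assoc]
  have hadj := Matrix.adjugate_apply_mem_of_subring (polynomialFunctions V)
    (fun θ : Matrix V V ℝ × Matrix V V ℝ => 1 - θ.1) one_sub_apply_mem_polynomialFunctions
  have hmem : (fun θ => (M θ).det) ∈ polynomialFunctions V := by
    refine Matrix.det_mem_of_subring _ M fun i j => ?_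
    by_cases hi : h i
    · simp only [M, Matrix.of_apply, hi, if_true]
      exact Matrix.mul_apply_mem_of_subring (X := Matrix V V ℝ × Matrix V V ℝ)
        (polynomialFunctions V) (fun θ => θ.2) (fun θ => (1 - θ.1).adjugate)
        snd_apply_mem_polynomialFunctions hadj _ _
    · simp only [M, Matrix.of_apply, hi, if_false]
      refine Matrix.mul_apply_mem_of_subring (X := Matrix V V ℝ × Matrix V V ℝ)
        (polynomialFunctions V) (fun θ => (1 - θ.1).adjugate.transpose * θ.2)
        (fun θ => (1 - θ.1).adjugate) (fun a b => ?_) hadj _ _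
      exact Matrix.mul_apply_mem_of_subring (X := Matrix V V ℝ × Matrix V V ℝ)
        (polynomialFunctions V) (fun θ => (1 - θ.1).adjugate.transpose)
        (fun θ => θ.2) (fun c d => hadj d c) snd_apply_mem_polynomialFunctions _ _
  obtain ⟨η, hη, hη0⟩ := hex
  refine ⟨_, hmem, ⟨η, hη, fun h0 => hη0 ?_⟩, fun θ hθ h0 => ?_⟩
  · rw [hdet, h0, mul_zero]
  · beta_reduce
    rw [hdet]
    have hunit := (Matrix.isUnit_iff_isUnit_det _).1 hθ.2.1
    have hinv : Ring.inverse (1 - θ.1).det ≠ 0 := by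
      rw [Ring.inverse_eq_inv']
      exact inv_ne_zero hunit.ne_zero
    refine mul_ne_zero (Finset.prod_ne_zero_iff.2 fun i _ => ?_) h0
    simp only [u]
    split_ifs
    · exact hinv
    · exact mul_ne_zero hinv hinv

theorem half_trek_part_eq {θ : Matrix V V ℝ × Matrix V V ℝ} (hθ : θ ∈ G.Theta) :
    (1 - θ.1).transpose * phi θ = θ.2 * (1 - θ.1)⁻¹ := by
  have hdet := (Matrix.isUnit_iff_isUnit_det _).1 hθ.2.1
  rw [phi, ← Matrix.mul_assoc, ← Matrix.mul_assoc, ← Matrix.transpose_mul,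
    Matrix.nonsing_inv_mul _ hdet, Matrix.transpose_one, Matrix.one_mul]

theorem phi_mul_one_sub {θ : Matrix V V ℝ × Matrix V V ℝ} (hθ : θ ∈ G.Theta) :
    phi θ * (1 - θ.1) = (1 - θ.1)⁻¹.transpose * θ.2 := by
  have hdet := (Matrix.isUnit_iff_isUnit_det _).1 hθ.2.1
  rw [phi, Matrix.mul_assoc, Matrix.nonsing_inv_mul _ hdet, Matrix.mul_one]

theorem mem_htr_of_reflTransGen {V : Type*} {G : MixedGraph V} {u v w : V}
    (hu : u ∉ ({v} ∪ G.sib v : Set V)) (hw : w = v ∨ G.bi w v) (h : Relation.ReflTransGen G.dir w u) : u ∈ G.htr v := by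
  obtain ⟨l, hl, hlast⟩ := List.exists_isChain_cons_of_relationReflTransGen h
  refine ⟨hu, ⟨[v], w :: l, by simp, by simp, by simp, hl, ?_⟩, ?_, rfl, hlast⟩
  · exact hw.imp Eq.symm (G.bi_symm _ _)
  · simp [Trek.IsHalfTrek, Trek.leftSet]

/-- If `u` is neither `v` nor a sibling of `v` nor half-trek reachable from `v`, then the entry of
`(I - Λ)⁻ᵀ Ω` at `(u, v)` vanishes. -/
theorem inv_transpose_mul_apply_eq_zero {θ : Matrix V V ℝ × Matrix V V ℝ} (hθ : θ ∈ G.Theta)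
    {u v : V} (hu : u ∉ ({v} ∪ G.sib v : Set V)) (huv : u ∉ G.htr v) :
    ((1 - θ.1)⁻¹.transpose * θ.2) u v = 0 := by
  rw [Matrix.mul_apply]
  refine Finset.sum_eq_zero fun w _ => ?_
  -- A nonzero summand would need w to be v or a sibling, and a directed path from w to u: together
  -- a half-trek from v to u.
  by_cases hw : w = v ∨ G.bi w v
  · rw [Matrix.transpose_apply, Matrix.inv_apply_eq_zero_of_support hθ.2.1
      (Q := Relation.ReflTransGen G.dir) (fun _ => .refl) (fun _ _ _ => .trans) ?_
      (fun h => huv (mem_htr_of_reflTransGen hu hw h)), zero_mul]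
    intro a b hab
    by_cases hd : G.dir a b
    · exact .single hd
    · by_cases heq : a = b
      · exact heq ▸ .refl
      · exact absurd (by simp [heq, hθ.1 a b hd]) hab
  · rw [not_or] at hw
    rw [hθ.2.2.2 w v hw.1 hw.2, mul_zero]

/-- The common shape of both kinds of equations: X is Ω(I - Λ)⁻¹ for a half-trek row and Σ for the
others. -/
theorem eq_sum_parents {ι : Type*} [Fintype ι] {p : ι → V} {v : V}
    (hpinj : Function.Injective p) (hprange : Set.range p = G.pa v)
    {θ : Matrix V V ℝ × Matrix V V ℝ} (hθ : θ ∈ G.Theta) {X : Matrix V V ℝ} {u : V}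
    (hX : (X * (1 - θ.1)) u v = 0) : ∑ j, X u (p j) * θ.1 (p j) v = X u v := by
  classical
  rw [Matrix.mul_sub, Matrix.mul_one, Matrix.sub_apply, sub_eq_zero, Matrix.mul_apply] at hX
  rw [hX, ← Finset.sum_image (s := Finset.univ) (f := fun w => X u w * θ.1 w v) hpinj.injOn]
  refine Finset.sum_subset (Finset.subset_univ _) fun w _ hw => ?_
  rw [hθ.1 w v fun hd => hw ?_, mul_zero]
  have : w ∈ Set.range p := hprange ▸ hd
  simpa using this

/-- Row u of (I - Λ)ᵀ Σ involves only column u of Λ; this is what makes the recursion possible. -/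
theorem half_trek_part_mem_recoverable {u : V}
    (h : ∀ a, (fun θ : Matrix V V ℝ × Matrix V V ℝ => θ.1 a u) ∈ G.recoverable) (b : V) :
    (fun θ : Matrix V V ℝ × Matrix V V ℝ => (θ.2 * (1 - θ.1)⁻¹) u b) ∈ G.recoverable := by
  refine mem_recoverable_congr (g := ∑ a, (fun θ => (1 - θ.1) a u) * fun θ => phi θ a b) ?_
    (.of_forall fun θ hθ => ?_)
  · refine sum_mem fun a _ => mul_mem (sub_mem (x := fun _ => (1 : Matrix V V ℝ) a u) ?_ (h a))
      (phi_apply_mem_recoverable a b)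
    by_cases hau : a = u
    · subst hau
      rw [Matrix.one_apply_eq]
      exact one_mem G.recoverable
    · rw [Matrix.one_apply_ne hau]
      exact zero_mem G.recoverable
  · rw [← half_trek_part_eq hθ, Matrix.mul_apply]
    simp [Finset.sum_apply]

/-- One step of the recursion: the column of `Λ` at `v` is a generically rational function of the
covariance matrix once the columns at the nodes of `Y ∩ htr(v)` are. -/
theorem HalfTrekCriterion.column_mem_recoverable {v : V} {Y : Set V}
    (hY : G.HalfTrekCriterion v Y)
    (ih : ∀ w ∈ Y ∩ G.htr v, ∀ a,
      (fun θ : Matrix V V ℝ × Matrix V V ℝ => θ.1 a w) ∈ G.recoverable) (a : V) :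
    (fun θ : Matrix V V ℝ × Matrix V V ℝ => θ.1 a v) ∈ G.recoverable := by
  classical
  by_cases ha : G.dir a v
  swap
  · exact mem_recoverable_congr (zero_mem G.recoverable) (.of_forall fun θ hθ =>
      (hθ.1 a v ha).symm)
  obtain ⟨R₀, hR₀⟩ := hY.exists_isLinkage
  obtain ⟨R, hR, hmin⟩ := hR₀.exists_minimal
  let y : Y → V := Subtype.val
  let p : Y → V := fun i => (R i).getLast (hR.ne_nil i)
  have hp : ∀ i, (R i).getLast? = some (p i) := fun i =>
    List.getLast?_eq_some_getLast (hR.ne_nil i)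
  have hpinj : Function.Injective p := fun i j hij =>
    hR.disjoint i j (p i) (List.mem_of_getLast? (hp i)) (hij ▸ List.mem_of_getLast? (hp j))
  -- The endpoints are distinct parents, and there are as many as parents by the cardinality
  -- condition.
  have hprange : Set.range p = G.pa v := by
    refine Set.eq_of_subset_of_ncard_le ?_ ?_ (Set.toFinite _)
    · rintro _ ⟨i, rfl⟩
      exact hR.last i _ (hp i)
    · rw [← hY.1, ← Set.image_univ, Set.ncard_image_of_injective _ hpinj, Set.ncard_univ,
        Nat.card_coe_set_eq]
  let h : Y → Prop := fun i => y i ∈ G.htr v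
  have hgen : G.Generically fun θ => (trekMatrix h y p θ).det ≠ 0 :=
    generically_det_trekMatrix_ne_zero h y p ⟨_, hR.witness_mem_paramSpace,
      hR.det_trekMatrix_ne_zero Subtype.val_injective hmin hp h⟩
  -- The rows with all columns kept: the columns `p k` form the coefficient matrix, column `v` the
  -- right-hand side.
  let B : Matrix V V ℝ × Matrix V V ℝ → Y → V → ℝ := fun θ i b =>
    if h i then (θ.2 * (1 - θ.1)⁻¹) (y i) b else phi θ (y i) b
  have hB : ∀ i b, (fun θ => B θ i b) ∈ G.recoverable := by
    intro i b
    by_cases hi : h i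
    · simp only [B, hi, if_true]
      exact half_trek_part_mem_recoverable (ih _ ⟨i.2, hi⟩) b
    · simp only [B, hi, if_false]
      exact phi_apply_mem_recoverable _ _
  have hsolve : ∀ θ ∈ G.Theta,
      (trekMatrix h y p θ).mulVec (fun j => θ.1 (p j) v) = fun i => B θ i v := by
    intro θ hθ
    funext i
    have hi : y i ∉ ({v} ∪ G.sib v : Set V) := fun hi =>
      (Set.eq_empty_iff_forall_notMem.1 hY.2.1) (y i) ⟨i.2, hi⟩
    by_cases hh : h i
    · simp only [Matrix.mulVec, dotProduct, trekMatrix, Matrix.of_apply, B, hh, if_true]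
      refine eq_sum_parents hpinj hprange hθ ?_
      rw [Matrix.mul_assoc, Matrix.nonsing_inv_mul _ ((Matrix.isUnit_iff_isUnit_det _).1 hθ.2.1),
        Matrix.mul_one]
      simp only [Set.mem_union, Set.mem_singleton_iff, not_or] at hi
      exact hθ.2.2.2 _ _ hi.1 hi.2
    · simp only [Matrix.mulVec, dotProduct, trekMatrix, Matrix.of_apply, B, hh, if_false]
      refine eq_sum_parents hpinj hprange hθ ?_
      rw [phi_mul_one_sub hθ]
      exact inv_transpose_mul_apply_eq_zero hθ hi hh
  obtain ⟨j, rfl⟩ : a ∈ Set.range p := hprange ▸ ha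
  have hdet : (fun θ => (trekMatrix h y p θ).det) ∈ G.recoverable :=
    Matrix.det_mem_of_subring _ _ fun i k => hB i (p k)
  have hnum : (fun θ => ((trekMatrix h y p θ).updateCol j fun i => B θ i v).det) ∈
      G.recoverable := by
    refine Matrix.det_mem_of_subring _
      (fun θ => (trekMatrix h y p θ).updateCol j fun i => B θ i v) fun i k => ?_
    by_cases hk : k = j
    · simpa [Matrix.updateCol_apply, hk] using hB i v
    · simp only [Matrix.updateCol_apply, hk, if_false]
      exact hB i (p k)
  refine mem_recoverable_congr (mul_mem (inv_mem_recoverable hdet hgen) hnum)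
    (hgen.mono fun θ hθ h0 => ?_)
  -- Cramer's rule: the determinant with column j replaced is det times the unknown.
  rw [Pi.mul_apply, ← Matrix.cramer_apply, ← hsolve θ hθ, Matrix.cramer_eq_adjugate_mulVec,
    Matrix.mulVec_mulVec, Matrix.adjugate_mul, Matrix.smul_mulVec, Matrix.one_mulVec,
    Pi.smul_apply, smul_eq_mul, inv_mul_cancel_left₀ h0]

theorem rationallyIdentifiable_of_columns
    (h : ∀ a b, (fun θ : Matrix V V ℝ × Matrix V V ℝ => θ.1 a b) ∈ G.recoverable) :
    G.RationallyIdentifiable := by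
  refine rationallyIdentifiable_of_recoverable h fun a b => ?_
  refine mem_recoverable_congr (g := (fun θ => (θ.2 * (1 - θ.1)⁻¹) a b) -
    ∑ c, (fun θ => (θ.2 * (1 - θ.1)⁻¹) a c) * fun θ => θ.1 c b) ?_ (.of_forall fun θ hθ => ?_)
  · have hT := half_trek_part_mem_recoverable fun c => h c a
    exact sub_mem (hT b) (sum_mem fun c _ => mul_mem (hT c) (h c b))
  · have hdet := (Matrix.isUnit_iff_isUnit_det _).1 hθ.2.1
    have heq : θ.2 * (1 - θ.1)⁻¹ * (1 - θ.1) = θ.2 := by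
      rw [Matrix.mul_assoc, Matrix.nonsing_inv_mul _ hdet, Matrix.mul_one]
    conv_rhs => rw [← heq]
    rw [Matrix.mul_sub, Matrix.mul_one, Matrix.sub_apply, Matrix.mul_apply (N := θ.1)]
    simp [Finset.sum_apply]

end MixedGraph

theorem theorem1 {V : Type*} [Fintype V] [DecidableEq V] (G : MixedGraph V) (Y : V → Set V)
    (hY : ∀ v, G.HalfTrekCriterion v (Y v))
    (hprec : ∃ prec : V → V → Prop, IsStrictTotalOrder V prec ∧
      ∀ v, ∀ w ∈ Y v ∩ G.htr v, prec w v) :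
    G.RationallyIdentifiable := by
  obtain ⟨prec, hord, hprec⟩ := hprec
  have hwf : WellFounded prec := Finite.wellFounded_of_trans_of_irrefl prec
  refine MixedGraph.rationallyIdentifiable_of_columns fun a v => ?_
  induction v using hwf.induction generalizing a with
  | _ v ih => exact (hY v).column_mem_recoverable (fun w hw => ih w (hprec v w hw)) a
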